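/- Let $\mathsf B$ be a locally presentable abelian category and let $P\in\mathsf B$ be a projective generator, that is, a projective object such that the functor $\operatorname{Hom}_{\mathsf B}(P,-)$ is faithful. Let $R$ be an associative unital ring, let $\theta\colon R\to\operatorname{Hom}_{\mathsf B}(P,P)^{\mathrm{op}}$ be a ring homomorphism (the multiplication of $\operatorname{Hom}_{\mathsf B}(P,P)$ being the composition of maps), and let $\Theta=\operatorname{Hom}_{\mathsf B}(P,-)\colon\mathsf B\to R\text{-}\mathrm{mod}$ be the resulting exact functor to the category of left $R$-modules, where $R$ acts on $\operatorname{Hom}_{\mathsf B}(P,B)$ by $r\cdot f=f\circ\theta(r)$. Then the following two conditions are equivalent: (i) the maps $\operatorname{Ext}^i_{\mathsf B}(B,C)\to\operatorname{Ext}^i_R(\Theta(B),\Theta(C))$ induced by $\Theta$ are isomorphisms for all objects $B,C\in\mathsf B$ and all integers $i\ge 0$; (ii) the triangulated functor $\mathsf D^-(\mathsf B)\to\mathsf D^-(R\text{-}\mathrm{mod})$ between the bounded above derived categories induced by $\Theta$ is fully faithful. -/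

import Mathlib

/-!
Let `F` be an exact functor which preserves countable products, between abelian categories in which
countable products are exact. Products of complexes are then also products in the derived
categories, and `F` preserves them there. A complex `K` is the fibre of `1 - shift` on the product
of its truncations `τ≥(-n) K`; if `K` is bounded above, these truncations are bounded. Hence a
triangulated subcategory closed under countable products which contains the objects of the abelian
category contains `D⁻`. Bijectivity of `F` on the morphisms from a fixed object into the shifts of a
variable one defines such a subcategory. Products are not available in the first variable, but
morphisms from a bounded above object to a bounded below object only involve a bounded truncation
of the source.

The functor `Hom(P, -)` preserves products and is exact and faithful, so it reflects exactness, and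
countable products are exact in `B` because they are so for modules.
-/

open CategoryTheory Limits

universe w₁ w₂ w₃ v v₁ v₂ u u₁ u₂

noncomputable section

namespace CategoryTheory.Functor

open DerivedCategory.TStructure

variable {C : Type u₁} [Category.{v₁} C] [Abelian C] [HasDerivedCategory.{w₁} C]
  {D : Type u₂} [Category.{v₂} D] [Abelian D] [HasDerivedCategory.{w₂} D]
  (F : C ⥤ D) [F.Additive] [PreservesFiniteLimits F] [PreservesFiniteColimits F]

/-- The functor on derived categories induced by an exact functor preserves the
bounded above objects. -/
lemma minus_mapDerivedCategory_obj (X : DerivedCategory.Minus C) :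
    (t : Triangulated.TStructure (DerivedCategory D)).minus
      (F.mapDerivedCategory.obj X.obj) := by
  obtain ⟨X, n, K, e, h⟩ := X
  refine ⟨n, ⟨(F.mapHomologicalComplex (ComplexShape.up ℤ)).obj K,
    F.mapDerivedCategory.mapIso e ≪≫ F.mapDerivedCategoryFactors.app K, ⟨fun i hi ↦ ?_⟩⟩⟩
  exact F.map_isZero (h.isZero i hi)

/-- The functor `D⁻(C) ⥤ D⁻(D)` induced by an exact functor `F : C ⥤ D` between abelian
categories: the restriction of `F.mapDerivedCategory : D(C) ⥤ D(D)`, which applies `F` to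
complexes termwise. -/
def mapDerivedCategoryMinus : DerivedCategory.Minus C ⥤ DerivedCategory.Minus D :=
  t.minus.lift (DerivedCategory.Minus.ι ⋙ F.mapDerivedCategory)
    F.minus_mapDerivedCategory_obj

instance : F.mapDerivedCategoryMinus.CommShift ℤ := by
  dsimp only [mapDerivedCategoryMinus]
  infer_instance

instance : F.mapDerivedCategoryMinus.IsTriangulated := by
  dsimp only [mapDerivedCategoryMinus]
  infer_instance

end CategoryTheory.Functor

section

variable {B : Type u} [Category.{v} B] [Abelian B] (P : B) {R : Type v} [Ring R]
  (θ : R →+* (End P)ᵐᵒᵖ)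

/-- The functor `Hom(P, -)` from an abelian category to left `R`-modules, where `R` acts on
`Hom(P, X)` by `r • f = f ∘ θ(r)` through a ring homomorphism `θ` from `R` to the opposite
ring of the endomorphism ring of `P`. -/
def homFunctor : B ⥤ ModuleCat.{v} R :=
  preadditiveCoyonedaObj P ⋙ ModuleCat.restrictScalars θ

instance : (homFunctor P θ).Additive := by
  dsimp only [homFunctor]; infer_instance

instance : PreservesFiniteLimits (homFunctor P θ) := by
  have : PreservesFiniteLimits (preadditiveCoyonedaObj P) := ⟨fun J _ _ ↦ inferInstance⟩
  have : PreservesFiniteLimits (ModuleCat.restrictScalars.{v} θ) :=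
    ⟨fun J _ _ ↦ ⟨inferInstance⟩⟩
  exact comp_preservesFiniteLimits _ _

instance [Projective P] : PreservesFiniteColimits (homFunctor P θ) := by
  dsimp only [homFunctor]; infer_instance

end

end

universe w₄

section ProductPreservation

variable {C D E : Type*} [Category* C] [Category* D] [Category* E] {J : Type*}
  (G : C ⥤ D) (H : D ⥤ E)

lemma preservesProducts_of_existsUnique_lift [HasProductsOfShape J C] [G.EssSurj]
    (h : ∀ (X : C) (Y : J → C) (f : ∀ j, G.obj X ⟶ G.obj (Y j)),
      ∃! g : G.obj X ⟶ G.obj (∏ᶜ Y), ∀ j, g ≫ G.map (Pi.π Y j) = f j) :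
    PreservesLimitsOfShape (Discrete J) G := by
  suffices ∀ Y : J → C, PreservesLimit (Discrete.functor Y) G from
    ⟨fun {K} ↦ preservesLimit_of_iso_diagram G Discrete.natIsoFunctor.symm⟩
  intro Y
  choose l hl hl' using fun X ↦ h X Y
  refine preservesLimit_of_preserves_limit_cone (productIsProduct Y)
    ((isLimitMapConeFanMkEquiv G Y _).symm (Fan.IsLimit.mk _
      (fun s ↦ (G.objObjPreimageIso _).inv ≫
        l _ (fun j ↦ (G.objObjPreimageIso s.pt).hom ≫ s.proj j))
      (fun s j ↦ ?_) (fun s m hm ↦ ?_)))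
  · simp [hl]
  · rw [Iso.eq_inv_comp]
    exact hl' _ _ _ (fun j ↦ by simp [← hm])

lemma preservesProducts_of_comp [HasProductsOfShape J C] [G.EssSurj]
    [PreservesLimitsOfShape (Discrete J) G] [PreservesLimitsOfShape (Discrete J) (G ⋙ H)] :
    PreservesLimitsOfShape (Discrete J) H where
  preservesLimit {K} := by
    let X (j : J) : C := G.objPreimage (K.obj ⟨j⟩)
    let e : Discrete.functor X ⋙ G ≅ K :=
      Discrete.natIso (fun j ↦ G.objObjPreimageIso (K.obj ⟨j.as⟩))
    have : PreservesLimit (Discrete.functor X ⋙ G) H :=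
      preservesLimit_of_preserves_limit_cone
        (isLimitOfPreserves G (limit.isLimit (Discrete.functor X)))
        (isLimitOfPreserves (G ⋙ H) (limit.isLimit (Discrete.functor X)))
    exact preservesLimit_of_iso_diagram H e

end ProductPreservation

noncomputable section ExactLimits

variable {A : Type*} [Category* A] {ι : Type*} {c : ComplexShape ι} {J : Type*} [Category* J]

/-- The functor turning a diagram of complexes into a complex of diagrams; it is inverse to
`HomologicalComplex.complexOfFunctorsToFunctorToComplex`. -/
def diagramToComplex [HasZeroMorphisms A] :
    (J ⥤ HomologicalComplex A c) ⥤ HomologicalComplex (J ⥤ A) c where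
  obj K :=
    { X i := K ⋙ HomologicalComplex.eval A c i
      d i j := { app x := (K.obj x).d i j, naturality _ _ f := (K.map f).comm i j }
      shape i j hij := by ext x; exact (K.obj x).shape i j hij
      d_comp_d' i j k _ _ := by ext x; exact (K.obj x).d_comp_d i j k }
  map φ :=
    { f i := Functor.whiskerRight φ (HomologicalComplex.eval A c i)
      comm' i j _ := by ext x; exact (φ.app x).comm i j }

lemma limit_lift_comp_limMap [HasLimitsOfShape J A] {F G : J ⥤ A} (α : F ⟶ G) {s : Cone F}
    {t : Cone G} (f : s.pt ⟶ t.pt) (hf : ∀ j, f ≫ t.π.app j = s.π.app j ≫ α.app j) :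
    limit.lift F s ≫ limMap α = f ≫ limit.lift G t :=
  limit.hom_ext (fun j ↦ by simp [hf])

section

variable [HasZeroMorphisms A] [HasLimitsOfShape J A]
  [(lim : (J ⥤ A) ⥤ A).PreservesZeroMorphisms] {K : J ⥤ HomologicalComplex A c}

/-- The comparison morphism from the tip of a cone of complexes to the termwise limit. -/
def toTermwiseLimit (s : Cone K) :
    s.pt ⟶ (lim.mapHomologicalComplex c).obj (diagramToComplex.obj K) where
  f i := limit.lift ((diagramToComplex.obj K).X i) ((HomologicalComplex.eval A c i).mapCone s)
  comm' i j _ := limit_lift_comp_limMap ((diagramToComplex.obj K).d i j)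
    (s := (HomologicalComplex.eval A c i).mapCone s)
    (t := (HomologicalComplex.eval A c j).mapCone s) (s.pt.d i j)
    (fun x ↦ ((s.π.app x).comm i j).symm)

lemma isIso_toTermwiseLimit {s : Cone K} (hs : IsLimit s) : IsIso (toTermwiseLimit s) := by
  have (i : ι) : IsIso ((toTermwiseLimit s).f i) :=
    ((isLimitOfPreserves (HomologicalComplex.eval A c i) hs).conePointUniqueUpToIso
      (limit.isLimit _)).isIso_hom
  exact HomologicalComplex.Hom.isIso_of_components _

end

instance quasiIso_isStableUnderLimitsOfShape [Abelian A] [HasLimitsOfShape J A]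
    [HasExactLimitsOfShape J A] :
    (HomologicalComplex.quasiIso A c).IsStableUnderLimitsOfShape J where
  condition K L s t hs ht f hf φ hφ := by
    have : (lim : (J ⥤ A) ⥤ A).Additive := Functor.additive_of_preserves_binary_products _
    have : QuasiIso (diagramToComplex.map f) := by
      rw [HomologicalComplex.quasiIso_iff_evaluation]
      exact hf
    have h : QuasiIso ((lim.mapHomologicalComplex c).map (diagramToComplex.map f)) :=
      HomologicalComplex.quasiIso_map_of_preservesHomology _ _
    have : IsIso (toTermwiseLimit s) := isIso_toTermwiseLimit hs
    have : IsIso (toTermwiseLimit t) := isIso_toTermwiseLimit ht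
    have fac : toTermwiseLimit s ≫ (lim.mapHomologicalComplex c).map (diagramToComplex.map f) =
        φ ≫ toTermwiseLimit t := by
      ext i : 1
      exact limit_lift_comp_limMap ((diagramToComplex.map f).f i)
        (s := (HomologicalComplex.eval A c i).mapCone s)
        (t := (HomologicalComplex.eval A c i).mapCone t) (φ.f i)
        (fun x ↦ HomologicalComplex.congr_hom (hφ x) i)
    have : QuasiIso (φ ≫ toTermwiseLimit t) := by
      rw [← fac]
      exact quasiIso_comp _ _
    exact quasiIso_of_comp_right φ (toTermwiseLimit t)

end ExactLimits

noncomputable section Homotopy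

variable {V : Type*} [Category* V] [Preadditive V] {ι : Type*} {c : ComplexShape ι} {J : Type*}
  [HasProductsOfShape J V]

/-- Products of complexes are computed termwise. -/
def isLimitFanPiX (K : J → HomologicalComplex V c) (i : ι) :
    IsLimit (Fan.mk ((∏ᶜ K).X i) (fun j ↦ (Pi.π K j).f i)) :=
  isLimitFanMkObjOfIsLimit (HomologicalComplex.eval V c i) K (Pi.π K) (productIsProduct K)

/-- Homotopies into a product of complexes can be constructed componentwise. -/
def homotopyToPi {K : J → HomologicalComplex V c} {L : HomologicalComplex V c} {f g : L ⟶ ∏ᶜ K}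
    (h : ∀ j, Homotopy (f ≫ Pi.π K j) (g ≫ Pi.π K j)) : Homotopy f g where
  hom i k := Fan.IsLimit.lift (isLimitFanPiX K k) (fun j ↦ (h j).hom i k)
  zero i k hik := Fan.IsLimit.hom_ext (isLimitFanPiX K k) _ _ (fun j ↦ by
    rw [Fan.IsLimit.fac, (h j).zero i k hik, zero_comp])
  comm i := Fan.IsLimit.hom_ext (isLimitFanPiX K i) _ _ (fun j ↦ by
    have hom_π (a b : ι) : Fan.IsLimit.lift (isLimitFanPiX K b) (fun j ↦ (h j).hom a b) ≫
        (Pi.π K j).f b = (h j).hom a b := Fan.IsLimit.fac (isLimitFanPiX K b) _ j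
    have comm_π := (h j).comm i
    simp only [HomologicalComplex.comp_f] at comm_π
    change f.f i ≫ (Pi.π K j).f i = (_ + _ + _) ≫ (Pi.π K j).f i
    rw [Preadditive.add_comp, Preadditive.add_comp, ← dNext_comp_right, ← prevD_comp_right,
      comm_π]
    simp only [hom_π])

end Homotopy

section DerivedProducts

variable {A : Type u} [Category.{v} A] [Abelian A]

open DerivedCategory

lemma quasiIso_piMap {J : Type*} [HasProductsOfShape J A] [HasExactLimitsOfShape (Discrete J) A]
    {K L : J → CochainComplex A ℤ} (s : ∀ j, K j ⟶ L j) (hs : ∀ j, QuasiIso (s j)) :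
    QuasiIso (Limits.Pi.map s) :=
  MorphismProperty.limMap (W := HomologicalComplex.quasiIso A (.up ℤ)) _ (fun j ↦ hs j.as)

variable [HasDerivedCategory.{w₁} A]

/- Homotopies become visible after a quasi-isomorphism `Y ⟶ Z` out of the target: this is the side
on which quasi-isomorphisms and homotopies can be multiplied over `j` in `Q_map_eq_of_comp_pi`. -/
lemma Q_map_eq_iff {X Y : CochainComplex A ℤ} (f g : X ⟶ Y) :
    Q.map f = Q.map g ↔ ∃ (Z : CochainComplex A ℤ) (s : Y ⟶ Z), QuasiIso s ∧
      Nonempty (Homotopy (f ≫ s) (g ≫ s)) := by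
  constructor
  · intro h
    have h' : Qh.map ((HomotopyCategory.quotient A (.up ℤ)).map f) =
        Qh.map ((HomotopyCategory.quotient A (.up ℤ)).map g) := by
      rw [← cancel_mono ((quotientCompQhIso A).hom.app Y), quotientCompQhIso_hom_naturality,
        quotientCompQhIso_hom_naturality, h]
    obtain ⟨Z, s, hs, fac⟩ :=
      (MorphismProperty.map_eq_iff_postcomp Qh (HomotopyCategory.quasiIso A (.up ℤ)) _ _).1 h'
    obtain ⟨Z, rfl⟩ := HomotopyCategory.quotient_obj_surjective Z
    obtain ⟨s, rfl⟩ := (HomotopyCategory.quotient _ _).map_surjective s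
    exact ⟨Z, s, (HomotopyCategory.quotient_map_mem_quasiIso_iff s).1 hs,
      ⟨HomotopyCategory.homotopyOfEq _ _ (by rw [Functor.map_comp, fac, Functor.map_comp])⟩⟩
  · rintro ⟨Z, s, _, ⟨h⟩⟩
    rw [← cancel_mono (Q.map s), ← Q.map_comp, ← Q.map_comp, Q_map_eq_of_homotopy _ h]

variable {J : Type*} [HasProductsOfShape J A] [HasExactLimitsOfShape (Discrete J) A]

lemma exists_lift_Q_obj_pi {X : CochainComplex A ℤ} {Y : J → CochainComplex A ℤ}
    (f : ∀ j, Q.obj X ⟶ Q.obj (Y j)) :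
    ∃ g : Q.obj X ⟶ Q.obj (∏ᶜ Y), ∀ j, g ≫ Q.map (Pi.π Y j) = f j := by
  choose Y' a s hs fac using fun j ↦ left_fac (f j)
  have : QuasiIso (Limits.Pi.map s) :=
    quasiIso_piMap s (fun j ↦ (isIso_Q_map_iff_quasiIso _ _).1 (hs j))
  refine ⟨Q.map (Pi.lift a) ≫ inv (Q.map (Limits.Pi.map s)), fun j ↦ ?_⟩
  have comm : inv (Q.map (Limits.Pi.map s)) ≫ Q.map (Pi.π Y j) =
      Q.map (Pi.π Y' j) ≫ inv (Q.map (s j)) := by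
    rw [IsIso.eq_comp_inv, Category.assoc, IsIso.inv_comp_eq, ← Q.map_comp, ← Q.map_comp,
      Pi.map_π]
  rw [Category.assoc, comm, ← Q.map_comp_assoc, Pi.lift_π, fac]

lemma Q_map_eq_of_comp_pi {X : CochainComplex A ℤ} {Y : J → CochainComplex A ℤ}
    {f g : X ⟶ ∏ᶜ Y} (h : ∀ j, Q.map (f ≫ Pi.π Y j) = Q.map (g ≫ Pi.π Y j)) :
    Q.map f = Q.map g := by
  choose Y' s hs H using fun j ↦ (Q_map_eq_iff _ _).1 (h j)
  refine (Q_map_eq_iff _ _).2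
    ⟨_, Limits.Pi.map s, quasiIso_piMap s hs, ⟨homotopyToPi (fun j ↦ ?_)⟩⟩
  simpa only [Category.assoc, Pi.map_π] using (H j).some

instance Q_preservesProducts :
    PreservesLimitsOfShape (Discrete J) (Q : CochainComplex A ℤ ⥤ DerivedCategory A) := by
  refine preservesProducts_of_existsUnique_lift _ (fun X Y f ↦
    existsUnique_of_exists_of_unique (exists_lift_Q_obj_pi f) (fun g₁ g₂ h₁ h₂ ↦ ?_))
  obtain ⟨X', s, _, a, fac⟩ := right_fac (g₁ - g₂)
  have ha : Q.map a = Q.map 0 := Q_map_eq_of_comp_pi (fun j ↦ by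
    have : Q.map a = Q.map s ≫ (g₁ - g₂) := by rw [fac, IsIso.hom_inv_id_assoc]
    rw [Q.map_comp, this, Category.assoc, Preadditive.sub_comp, h₁, h₂, sub_self, comp_zero,
      zero_comp, Q.map_zero])
  rw [← sub_eq_zero, fac, ha, Q.map_zero, comp_zero]

lemma mapDerivedCategory_preservesProducts {A' : Type u₁} [Category.{v₁} A'] [Abelian A']
    [HasDerivedCategory.{w₂} A'] [HasProductsOfShape J A']
    [HasExactLimitsOfShape (Discrete J) A'] (F : A ⥤ A') [F.Additive] [PreservesFiniteLimits F]
    [PreservesFiniteColimits F] [PreservesLimitsOfShape (Discrete J) F] :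
    PreservesLimitsOfShape (Discrete J) F.mapDerivedCategory :=
  have : PreservesLimitsOfShape (Discrete J) (Q ⋙ F.mapDerivedCategory) :=
    preservesLimitsOfShape_of_natIso F.mapDerivedCategoryFactors.symm
  preservesProducts_of_comp Q F.mapDerivedCategory

end DerivedProducts

section BijectiveOnHom

section

variable {C D : Type*} [Category* C] [Category* D] (F : C ⥤ D)

/-- The property that `F` maps the morphisms `X ⟶ Y` bijectively to the morphisms
`F.obj X ⟶ F.obj Y`. -/
def BijectiveOnHom (X Y : C) : Prop :=
  Function.Bijective (F.map : (X ⟶ Y) → (F.obj X ⟶ F.obj Y))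

variable {F}

lemma full_and_faithful_iff_bijectiveOnHom :
    F.Full ∧ F.Faithful ↔ ∀ X Y, BijectiveOnHom F X Y :=
  ⟨fun ⟨_, _⟩ _ _ ↦ ⟨F.map_injective, F.map_surjective⟩,
    fun h ↦ ⟨⟨(h _ _).2⟩, ⟨fun hfg ↦ (h _ _).1 hfg⟩⟩⟩

namespace BijectiveOnHom

lemma of_iso {X Y X' Y' : C} (h : BijectiveOnHom F X Y) (e : X ≅ X') (e' : Y ≅ Y') :
    BijectiveOnHom F X' Y' := by
  have fac : F.map = (F.mapIso e).homCongr (F.mapIso e') ∘ F.map ∘ (e.homCongr e').symm := by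
    ext f
    change F.map f = F.map e.inv ≫ F.map (e.hom ≫ f ≫ e'.inv) ≫ F.map e'.hom
    simp only [← F.map_comp, Category.assoc, Iso.inv_hom_id_assoc, Iso.inv_hom_id,
      Category.comp_id]
  rw [BijectiveOnHom, fac]
  exact (Equiv.bijective _).comp (h.comp (Equiv.bijective _))

lemma of_isLimit {J : Type*} [Category* J] {K : J ⥤ C} [PreservesLimit K F] {c : Cone K}
    (hc : IsLimit c) {X : C} (h : ∀ j, BijectiveOnHom F X (K.obj j)) :
    BijectiveOnHom F X c.pt := by
  have hFc := isLimitOfPreserves F hc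
  refine ⟨fun f g hfg ↦ hc.hom_ext (fun j ↦ (h j).1 ?_), fun f ↦ ?_⟩
  · rw [F.map_comp, F.map_comp, hfg]
  · choose l hl using fun j ↦ (h j).2 (f ≫ F.map (c.π.app j))
    let s : Cone K :=
      { pt := X
        π :=
          { app := l
            naturality i j a := (h j).1 (by
              simp [hl, ← F.map_comp]) } }
    refine ⟨hc.lift s, hFc.hom_ext (fun j ↦ ?_)⟩
    rw [Functor.mapCone_π_app, ← F.map_comp, hc.fac, hl]

section

variable [HasZeroMorphisms C] [HasZeroMorphisms D] [F.PreservesZeroMorphisms]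

lemma of_forall_eq_zero {X Y : C} (h : ∀ f : X ⟶ Y, f = 0) (h' : ∀ f : F.obj X ⟶ F.obj Y, f = 0) :
    BijectiveOnHom F X Y :=
  ⟨fun f g _ ↦ (h f).trans (h g).symm, fun f ↦ ⟨0, F.map_zero X Y |>.trans (h' f).symm⟩⟩

lemma of_isZero_right {X Y : C} (hY : IsZero Y) : BijectiveOnHom F X Y :=
  .of_forall_eq_zero (fun _ ↦ hY.eq_of_tgt _ _) (fun _ ↦ (F.map_isZero hY).eq_of_tgt _ _)

lemma of_isZero_left {X Y : C} (hX : IsZero X) : BijectiveOnHom F X Y :=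
  .of_forall_eq_zero (fun _ ↦ hX.eq_of_src _ _) (fun _ ↦ (F.map_isZero hX).eq_of_src _ _)

end

end BijectiveOnHom

lemma bijectiveOnHom_of_fullyFaithful [F.Full] [F.Faithful] (X Y : C) : BijectiveOnHom F X Y :=
  ⟨F.map_injective, F.map_surjective⟩

lemma bijectiveOnHom_iff_of_natIso {G : C ⥤ D} (e : F ≅ G) (X Y : C) :
    BijectiveOnHom F X Y ↔ BijectiveOnHom G X Y := by
  have fac : G.map = (e.app X).homCongr (e.app Y) ∘ (F.map : (X ⟶ Y) → _) := by
    ext f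
    simp [Iso.homCongr]
  rw [BijectiveOnHom, BijectiveOnHom, fac, Function.Bijective.of_comp_iff' (Equiv.bijective _)]

section

variable {E : Type*} [Category* E]

lemma bijectiveOnHom_comp_iff (G : D ⥤ E) [G.Full] [G.Faithful] (X Y : C) :
    BijectiveOnHom (F ⋙ G) X Y ↔ BijectiveOnHom F X Y :=
  Function.Bijective.of_comp_iff' (bijectiveOnHom_of_fullyFaithful (F := G) _ _) F.map

lemma bijectiveOnHom_obj_iff (G : E ⥤ C) [G.Full] [G.Faithful] (X Y : E) :
    BijectiveOnHom F (G.obj X) (G.obj Y) ↔ BijectiveOnHom (G ⋙ F) X Y :=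
  (Function.Bijective.of_comp_iff F.map (bijectiveOnHom_of_fullyFaithful (F := G) X Y)).symm

end

lemma bijectiveOnHom_shift_iff [HasShift C ℤ] [HasShift D ℤ] [F.CommShift ℤ] (X Y : C) (a : ℤ) :
    BijectiveOnHom F (X⟦a⟧) (Y⟦a⟧) ↔ BijectiveOnHom F X Y := by
  rw [bijectiveOnHom_obj_iff, bijectiveOnHom_iff_of_natIso (F.commShiftIso a),
    bijectiveOnHom_comp_iff]

end

open Pretriangulated

variable {C D : Type*} [Category* C] [Preadditive C] [HasZeroObject C] [HasShift C ℤ]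
  [∀ n : ℤ, (shiftFunctor C n).Additive] [Pretriangulated C]
  [Category* D] [Preadditive D] [HasZeroObject D] [HasShift D ℤ]
  [∀ n : ℤ, (shiftFunctor D n).Additive] [Pretriangulated D]

lemma exact_rightComp_of_distTriang {T : Triangle C} (hT : T ∈ distTriang C) (X : C) :
    Function.Exact (Preadditive.rightComp X T.mor₁) (Preadditive.rightComp X T.mor₂) :=
  fun f ↦ ⟨fun hf ↦ (T.coyoneda_exact₂ hT f hf).imp fun _ h ↦ h.symm, by
    rintro ⟨g, rfl⟩
    exact (Category.assoc _ _ _).trans (by rw [comp_distTriang_mor_zero₁₂ _ hT, comp_zero])⟩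

lemma exact_leftComp_of_distTriang {T : Triangle C} (hT : T ∈ distTriang C) (Y : C) :
    Function.Exact (Preadditive.leftComp Y T.mor₂) (Preadditive.leftComp Y T.mor₁) :=
  fun f ↦ ⟨fun hf ↦ (T.yoneda_exact₂ hT f hf).imp fun _ h ↦ h.symm, by
    rintro ⟨g, rfl⟩
    exact comp_distTriang_mor_zero₁₂_assoc _ hT g |>.trans zero_comp⟩

variable {F : C ⥤ D} [F.CommShift ℤ] [F.IsTriangulated]

namespace BijectiveOnHom

lemma of_distTriang_right {X : C} {T : Triangle C} (hT : T ∈ distTriang C)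
    (h₁ : BijectiveOnHom F X T.obj₁) (h₃ : BijectiveOnHom F X T.obj₃)
    (h₁' : BijectiveOnHom F X (T.obj₁⟦(1 : ℤ)⟧)) (h₃' : BijectiveOnHom F X (T.obj₃⟦(-1 : ℤ)⟧)) :
    BijectiveOnHom F X T.obj₂ := by
  have hT' := inv_rot_of_distTriang _ hT
  have hT'' := rot_of_distTriang _ hT
  refine AddMonoidHom.bijective_of_surjective_of_bijective_of_bijective_of_injective
    (Preadditive.rightComp X T.invRotate.mor₁) (Preadditive.rightComp X T.mor₁)
    (Preadditive.rightComp X T.mor₂) (Preadditive.rightComp X T.mor₃)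
    (Preadditive.rightComp (F.obj X) (F.map T.invRotate.mor₁))
    (Preadditive.rightComp (F.obj X) (F.map T.mor₁))
    (Preadditive.rightComp (F.obj X) (F.map T.mor₂))
    (Preadditive.rightComp (F.obj X) (F.map T.mor₃))
    F.mapAddHom F.mapAddHom F.mapAddHom F.mapAddHom F.mapAddHom ?_ ?_ ?_ ?_
    (exact_rightComp_of_distTriang hT' X) (exact_rightComp_of_distTriang hT X)
    (exact_rightComp_of_distTriang hT'' X)
    (exact_rightComp_of_distTriang (F.map_distinguished _ hT') (F.obj X))
    (exact_rightComp_of_distTriang (F.map_distinguished _ hT) (F.obj X))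
    (exact_rightComp_of_distTriang (F.map_distinguished _ hT'') (F.obj X)) h₃'.2 h₁ h₃ h₁'.1
  all_goals
    ext f
    exact (F.map_comp f _).symm

lemma of_distTriang_left {Y : C} {T : Triangle C} (hT : T ∈ distTriang C)
    (h₁ : BijectiveOnHom F T.obj₁ Y) (h₃ : BijectiveOnHom F T.obj₃ Y)
    (h₁' : BijectiveOnHom F (T.obj₁⟦(1 : ℤ)⟧) Y) (h₃' : BijectiveOnHom F (T.obj₃⟦(-1 : ℤ)⟧) Y) :
    BijectiveOnHom F T.obj₂ Y := by
  have hT' := inv_rot_of_distTriang _ hT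
  have hT'' := rot_of_distTriang _ hT
  refine AddMonoidHom.bijective_of_surjective_of_bijective_of_bijective_of_injective
    (Preadditive.leftComp Y T.mor₃) (Preadditive.leftComp Y T.mor₂)
    (Preadditive.leftComp Y T.mor₁) (Preadditive.leftComp Y T.invRotate.mor₁)
    (Preadditive.leftComp (F.obj Y) (F.map T.mor₃))
    (Preadditive.leftComp (F.obj Y) (F.map T.mor₂))
    (Preadditive.leftComp (F.obj Y) (F.map T.mor₁))
    (Preadditive.leftComp (F.obj Y) (F.map T.invRotate.mor₁))
    F.mapAddHom F.mapAddHom F.mapAddHom F.mapAddHom F.mapAddHom ?_ ?_ ?_ ?_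
    (exact_leftComp_of_distTriang hT'' Y) (exact_leftComp_of_distTriang hT Y)
    (exact_leftComp_of_distTriang hT' Y)
    (exact_leftComp_of_distTriang (F.map_distinguished _ hT'') (F.obj Y))
    (exact_leftComp_of_distTriang (F.map_distinguished _ hT) (F.obj Y))
    (exact_leftComp_of_distTriang (F.map_distinguished _ hT') (F.obj Y)) h₁'.2 h₃ h₁ h₃'.1
  all_goals
    ext f
    exact (F.map_comp _ f).symm

end BijectiveOnHom

variable (F)

/-- The objects `Y` such that `F` is bijective on the morphisms `X ⟶ Y⟦n⟧`. All shifts `n : ℤ` are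
required at once, so that these objects form a triangulated subcategory. -/
def bijectiveTargets (X : C) : ObjectProperty C :=
  fun Y ↦ ∀ n : ℤ, BijectiveOnHom F X (Y⟦n⟧)

/-- The objects `X` such that `F` is bijective on the morphisms `X ⟶ Y⟦n⟧`, again for all shifts
`n : ℤ` at once. -/
def bijectiveSources (Y : C) : ObjectProperty C :=
  fun X ↦ ∀ n : ℤ, BijectiveOnHom F X (Y⟦n⟧)

instance bijectiveTargets_isClosedUnderIsomorphisms (X : C) :
    (bijectiveTargets F X).IsClosedUnderIsomorphisms where
  of_iso e h n := (h n).of_iso (Iso.refl _) ((shiftFunctor C n).mapIso e)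

instance bijectiveSources_isClosedUnderIsomorphisms (Y : C) :
    (bijectiveSources F Y).IsClosedUnderIsomorphisms where
  of_iso e h n := (h n).of_iso e (Iso.refl _)

instance bijectiveTargets_isClosedUnderLimitsOfShape (X : C) {J : Type*} [Category* J]
    [PreservesLimitsOfShape J F] : (bijectiveTargets F X).IsClosedUnderLimitsOfShape J where
  limitsOfShape_le := by
    rintro Y ⟨p⟩ n
    exact .of_isLimit (isLimitOfPreserves (shiftFunctor C n) p.isLimit)
      (fun j ↦ p.prop_diag_obj j n)

instance bijectiveTargets_isTriangulated (X : C) : (bijectiveTargets F X).IsTriangulated where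
  exists_zero := ⟨_, isZero_zero C, fun n ↦ .of_isZero_right
    ((shiftFunctor C n).map_isZero (isZero_zero C))⟩
  isStableUnderShiftBy a :=
    ⟨fun Y hY n ↦ (hY (a + n)).of_iso (Iso.refl _) ((shiftFunctorAdd C a n).app Y)⟩
  ext₂' T hT h₁ h₃ := ObjectProperty.le_isoClosure _ _ (fun n ↦
    .of_distTriang_right (Triangle.shift_distinguished T hT n) (h₁ n) (h₃ n)
      ((h₁ (n + 1)).of_iso (Iso.refl _) ((shiftFunctorAdd C n 1).app _))
      ((h₃ (n + -1)).of_iso (Iso.refl _) ((shiftFunctorAdd C n (-1)).app _)))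

instance bijectiveSources_isStableUnderShift (Y : C) :
    (bijectiveSources F Y).IsStableUnderShift ℤ where
  isStableUnderShiftBy a :=
    ⟨fun X hX n ↦ ((bijectiveOnHom_shift_iff X _ a).2 (hX (n - a))).of_iso (Iso.refl _)
      ((shiftFunctorAdd' C (n - a) a n (by lia)).symm.app Y)⟩

instance bijectiveSources_isTriangulated (Y : C) : (bijectiveSources F Y).IsTriangulated where
  exists_zero := ⟨_, isZero_zero C, fun _ ↦ .of_isZero_left (isZero_zero C)⟩
  ext₂' _ hT h₁ h₃ := ObjectProperty.le_isoClosure _ _ (fun n ↦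
    .of_distTriang_left hT (h₁ n) (h₃ n) ((bijectiveSources F Y).le_shift 1 _ h₁ n)
      ((bijectiveSources F Y).le_shift (-1) _ h₃ n))

end BijectiveOnHom

section Tower

variable {C : Type*} [Category* C] [Preadditive C]

lemma existsUnique_sub_comp_eq {A : ℕ → C} {r : ∀ n, A (n + 1) ⟶ A n} {N : ℕ}
    (hr : ∀ n ≥ N, IsIso (r n)) {Z : C} (z : Z ⟶ A N) (y : ∀ n, Z ⟶ A n) :
    ∃! x : ∀ n, Z ⟶ A n, x N = z ∧ ∀ n, x n - x (n + 1) ≫ r n = y n := by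
  induction N generalizing A with
  | zero =>
    have (n : ℕ) : IsIso (r n) := hr n (Nat.zero_le n)
    refine ⟨fun n ↦ n.rec z (fun n x ↦ (x - y n) ≫ inv (r n)), ⟨rfl, fun n ↦ by simp⟩,
      fun x ⟨hx, hx'⟩ ↦ funext (fun n ↦ ?_)⟩
    induction n with
    | zero => exact hx
    | succ n hn =>
      have hx_succ : x (n + 1) = (x n - y n) ≫ inv (r n) := by simp [← hx']
      rw [hx_succ, hn]
  | succ N h =>
    obtain ⟨x, ⟨hx, hx'⟩, unique⟩ :=
      h (r := fun n ↦ r (n + 1)) (fun n hn ↦ hr _ (by lia)) z (fun n ↦ y (n + 1))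
    refine ⟨fun n ↦ n.casesOn (y 0 + x 0 ≫ r 0) x, ⟨hx, fun n ↦ ?_⟩, fun x' ⟨hz, hx''⟩ ↦ ?_⟩
    · cases n with
      | zero => exact add_sub_cancel_right _ _
      | succ n => exact hx' n
    · obtain rfl := unique (fun n ↦ x' (n + 1)) ⟨hz, fun n ↦ hx'' (n + 1)⟩
      funext n
      cases n with
      | zero => exact sub_eq_iff_eq_add.1 (hx'' 0)
      | succ n => rfl

lemma nonempty_splitting_of_isLimit_fan {A : ℕ → C} {r : ∀ n, A (n + 1) ⟶ A n} {N : ℕ}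
    (hr : ∀ n ≥ N, IsIso (r n)) {K T : C} {p : ∀ n, T ⟶ A n} (hp : IsLimit (Fan.mk T p))
    {f : K ⟶ T} {g : T ⟶ T} (w : f ≫ g = 0) (hf : IsIso (f ≫ p N))
    (hg : ∀ n, g ≫ p n = p n - p (n + 1) ≫ r n) :
    Nonempty (ShortComplex.mk f g w).Splitting := by
  obtain ⟨x, ⟨hxN, hx⟩, -⟩ := existsUnique_sub_comp_eq hr (0 : T ⟶ A N) p
  let s : T ⟶ T := Fan.IsLimit.lift hp x
  have s_p (n : ℕ) : s ≫ p n = x n := Fan.IsLimit.fac hp x n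
  have s_g : s ≫ g = 𝟙 T := Fan.IsLimit.hom_ext hp _ _ (fun n ↦ by
    change (s ≫ g) ≫ p n = 𝟙 T ≫ p n
    rw [Category.assoc, hg, Preadditive.comp_sub, s_p, reassoc_of% s_p, hx, Category.id_comp])
  let ρ : T ⟶ K := p N ≫ inv (f ≫ p N)
  have ρ_f_p : (ρ ≫ f) ≫ p N = p N := by
    rw [Category.assoc, Category.assoc, IsIso.inv_hom_id, Category.comp_id]
  have id_p : (fun n ↦ (ρ ≫ f + g ≫ s) ≫ p n) = p :=
    (existsUnique_sub_comp_eq hr (p N) (fun n ↦ g ≫ p n)).unique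
      ⟨by rw [Preadditive.add_comp, ρ_f_p, Category.assoc, s_p, hxN, comp_zero, add_zero],
        fun n ↦ by
          rw [Category.assoc _ (p (n + 1)), ← Preadditive.comp_sub, ← hg, Preadditive.add_comp,
            Category.assoc, reassoc_of% w, zero_comp, comp_zero, zero_add, Category.assoc,
            reassoc_of% s_g]⟩
      ⟨rfl, fun n ↦ (hg n).symm⟩
  exact ⟨{ r := ρ
           s := s
           f_r := by rw [← Category.assoc, IsIso.hom_inv_id]
           s_g := s_g
           id := Fan.IsLimit.hom_ext hp _ _ (fun n ↦
             (congr_fun id_p n).trans (Category.id_comp _).symm) }⟩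

end Tower

section Truncation

variable {A : Type*} [Category* A] [Abelian A] (K : CochainComplex A ℤ)

lemma epi_πTruncGE_f (n i : ℤ) : Epi ((K.πTruncGE n).f i) := by
  dsimp only [CochainComplex.πTruncGE]
  infer_instance

lemma isIso_πTruncGE_f (n i : ℤ) (hi : n < i) : IsIso ((K.πTruncGE n).f i) := by
  obtain ⟨k, rfl⟩ := Int.le.dest hi.le
  refine ((ComplexShape.embeddingUpIntGE n).isIso_liftExtend_f_iff _
    (K.restrictionToTruncGE'_hasLift _) (i := k) rfl).2 (K.isIso_restrictionToTruncGE' _ _ ?_)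
  rw [ComplexShape.boundaryGE_embeddingUpIntGE_iff]
  lia

lemma exists_πTruncGE_comp_eq {m n : ℤ} (h : m < n) :
    ∃ r : K.truncGE m ⟶ K.truncGE n, K.πTruncGE m ≫ r = K.πTruncGE n := by
  have : Epi (K.πTruncGE m) := HomologicalComplex.epi_of_epi_f _ (epi_πTruncGE_f K m)
  refine ⟨Abelian.epiDesc (K.πTruncGE m) (K.πTruncGE n) ?_, Abelian.comp_epiDesc _ _ _⟩
  ext i
  by_cases hi : m < i
  · have := isIso_πTruncGE_f K m i hi
    have ker_f : (kernel.ι (K.πTruncGE m)).f i = 0 := by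
      rw [← cancel_mono ((K.πTruncGE m).f i), ← HomologicalComplex.comp_f, kernel.condition,
        HomologicalComplex.zero_f, zero_comp]
    rw [HomologicalComplex.comp_f, ker_f, zero_comp, HomologicalComplex.zero_f]
  · exact (K.truncGE n).isZero_of_isStrictlyGE n i |>.eq_of_tgt _ _

/- Near a fixed degree the tower of truncations is eventually constant, hence the sequence is
degreewise split and its exactness requires nothing about products in `A`. -/
lemma exists_shortExact_pi_truncGE [HasProductsOfShape ℕ A] :
    ∃ (f : K ⟶ ∏ᶜ fun n : ℕ ↦ K.truncGE (-n : ℤ))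
      (g : (∏ᶜ fun n : ℕ ↦ K.truncGE (-n : ℤ)) ⟶ ∏ᶜ fun n : ℕ ↦ K.truncGE (-n : ℤ))
      (w : f ≫ g = 0), (ShortComplex.mk f g w).ShortExact := by
  choose r hr using fun n : ℕ ↦
    exists_πTruncGE_comp_eq K (show (-(n + 1 : ℕ) : ℤ) < -n by lia)
  let p := Pi.π (fun n : ℕ ↦ K.truncGE (-n : ℤ))
  let f := Pi.lift (fun n : ℕ ↦ K.πTruncGE (-n : ℤ))
  let g := Pi.lift (fun n : ℕ ↦ p n - p (n + 1) ≫ r n)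
  have f_p (n : ℕ) : f ≫ p n = K.πTruncGE (-n : ℤ) := Pi.lift_π _ n
  have g_p (n : ℕ) : g ≫ p n = p n - p (n + 1) ≫ r n := Pi.lift_π _ n
  have w : f ≫ g = 0 := Pi.hom_ext _ _ (fun n ↦ by
    rw [Category.assoc, g_p, Preadditive.comp_sub, reassoc_of% f_p, hr, f_p, sub_self, zero_comp])
  refine ⟨f, g, w, HomologicalComplex.shortExact_of_degreewise_shortExact _ (fun i ↦ ?_)⟩
  have isIso_π (n : ℕ) (hn : (-i).toNat + 1 ≤ n) : IsIso ((K.πTruncGE (-n : ℤ)).f i) :=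
    isIso_πTruncGE_f K _ _ (by lia)
  have isIso_r (n : ℕ) (hn : (-i).toNat + 1 ≤ n) : IsIso ((r n).f i) := by
    have := isIso_π n hn
    have := isIso_π (n + 1) (by lia)
    exact IsIso.of_isIso_fac_left (HomologicalComplex.congr_hom (hr n) i)
  have isIso_f_p : IsIso (f.f i ≫ (p ((-i).toNat + 1)).f i) := by
    rw [← HomologicalComplex.comp_f, f_p]
    exact isIso_π _ le_rfl
  obtain ⟨splitting⟩ := nonempty_splitting_of_isLimit_fan isIso_r (isLimitFanPiX _ i)
    (HomologicalComplex.congr_hom w i) isIso_f_p (fun n ↦ HomologicalComplex.congr_hom (g_p n) i)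
  exact splitting.shortExact

end Truncation

section Devissage

open DerivedCategory DerivedCategory.TStructure Pretriangulated Triangulated

variable {C : Type u₁} [Category.{v₁} C] [Abelian C] [HasDerivedCategory.{w₁} C]

section

variable (S : ObjectProperty (DerivedCategory C)) [S.IsTriangulated]
  [S.IsClosedUnderIsomorphisms]

lemma prop_of_singleFunctor_of_isGE_of_isLE (hS : ∀ X : C, S ((singleFunctor C 0).obj X))
    (Y : DerivedCategory C) (a b : ℤ) [Y.IsGE a] [Y.IsLE b] : S Y := by
  have prop_of_single_degree (Y : DerivedCategory C) (a : ℤ) [Y.IsGE a] [Y.IsLE a] : S Y := by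
    obtain ⟨X, ⟨e⟩⟩ := exists_iso_singleFunctor_obj_of_isGE_of_isLE Y a
    exact S.prop_of_iso (((singleFunctors C).shiftIso (-a) a 0 (by simp)).app X ≪≫ e.symm)
      (S.le_shift (-a) _ (hS X))
  obtain hab | hab := lt_or_ge b a
  · exact S.prop_of_isZero (t.isZero Y b a)
  obtain ⟨n, rfl⟩ := Int.le.dest hab
  clear hab
  induction n generalizing Y a with
  | zero =>
    have : Y.IsLE a := by simpa using (inferInstance : Y.IsLE (a + (0 : ℕ)))
    exact prop_of_single_degree Y a
  | succ n hn =>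
    have : ((t.truncGE (a + 1)).obj Y).IsLE (a + 1 + n) :=
      t.isLE_of_le _ (a + (n + 1 : ℕ)) _ (by push_cast; lia)
    have prop_truncLT : S ((t.truncLT (a + 1)).obj Y) := prop_of_single_degree _ a
    have prop_truncGE : S ((t.truncGE (a + 1)).obj Y) := hn _ (a + 1)
    exact S.ext_of_isTriangulatedClosed₂ _ (t.triangleLTGE_distinguished (a + 1) Y)
      prop_truncLT prop_truncGE

lemma prop_of_singleFunctor_of_minus [HasProductsOfShape ℕ C]
    [HasExactLimitsOfShape (Discrete ℕ) C] [S.IsClosedUnderLimitsOfShape (Discrete ℕ)]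
    (hS : ∀ X : C, S ((singleFunctor C 0).obj X)) {Y : DerivedCategory C} (hY : t.minus Y) :
    S Y := by
  obtain ⟨b, K, e, _⟩ := hY
  obtain ⟨f, g, w, h⟩ := exists_shortExact_pi_truncGE K
  have prop_truncGE (n : ℕ) : S (Q.obj (K.truncGE (-n : ℤ))) :=
    prop_of_singleFunctor_of_isGE_of_isLE S hS _ (-n : ℤ) b
  have prop_pi : S (Q.obj (∏ᶜ fun n : ℕ ↦ K.truncGE (-n : ℤ))) :=
    S.prop_of_isLimit (isLimitOfPreserves Q (limit.isLimit _)) (fun n ↦ prop_truncGE n.as)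
  exact S.prop_of_iso e.symm
    (S.ext_of_isTriangulatedClosed₁ _ (triangleOfSES_distinguished h) prop_pi prop_pi)

end

variable {D : Type u₂} [Category.{v₂} D] [Abelian D] [HasDerivedCategory.{w₂} D]
  (F : C ⥤ D) [F.Additive] [PreservesFiniteLimits F] [PreservesFiniteColimits F]

lemma isLE_mapDerivedCategory_obj (X : DerivedCategory C) (n : ℤ) [X.IsLE n] :
    (F.mapDerivedCategory.obj X).IsLE n := by
  obtain ⟨K, _, ⟨e⟩⟩ := exists_iso_Q_obj_of_isLE X n
  have : (Q.obj ((F.mapHomologicalComplex (.up ℤ)).obj K)).IsLE n := inferInstance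
  exact t.isLE_of_iso (X := Q.obj ((F.mapHomologicalComplex (.up ℤ)).obj K))
    (F.mapDerivedCategory.mapIso e ≪≫ F.mapDerivedCategoryFactors.app K).symm n

lemma isGE_mapDerivedCategory_obj (X : DerivedCategory C) (n : ℤ) [X.IsGE n] :
    (F.mapDerivedCategory.obj X).IsGE n := by
  obtain ⟨K, _, ⟨e⟩⟩ := exists_iso_Q_obj_of_isGE X n
  have : (Q.obj ((F.mapHomologicalComplex (.up ℤ)).obj K)).IsGE n := inferInstance
  exact t.isGE_of_iso (X := Q.obj ((F.mapHomologicalComplex (.up ℤ)).obj K))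
    (F.mapDerivedCategory.mapIso e ≪≫ F.mapDerivedCategoryFactors.app K).symm n

lemma bijectiveOnHom_of_isLE_of_isGE {X Y : DerivedCategory C} (a b : ℤ) (hab : a < b) [X.IsLE a]
    [Y.IsGE b] : BijectiveOnHom F.mapDerivedCategory X Y := by
  have := isLE_mapDerivedCategory_obj F X a
  have := isGE_mapDerivedCategory_obj F Y b
  exact .of_forall_eq_zero (fun f ↦ t.zero f a b) (fun f ↦ t.zero f a b)

/- The other truncation of `X` and its shift lie in degrees `< b`, so they have no nonzero
morphisms to `Y`. -/
lemma bijectiveOnHom_of_truncGE {X Y : DerivedCategory C} (b : ℤ) [Y.IsGE b]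
    (h : BijectiveOnHom F.mapDerivedCategory ((t.truncGE b).obj X) Y)
    (h' : BijectiveOnHom F.mapDerivedCategory (((t.truncGE b).obj X)⟦(-1 : ℤ)⟧) Y) :
    BijectiveOnHom F.mapDerivedCategory X Y := by
  have isLE : ((t.truncLT b).obj X).IsLE (b - 1) := inferInstance
  have isLE_shift : (((t.truncLT b).obj X)⟦(1 : ℤ)⟧).IsLE (b - 2) :=
    t.isLE_shift ((t.truncLT b).obj X) (b - 1) 1 (b - 2)
  exact .of_distTriang_left (t.triangleLTGE_distinguished b X)
    (bijectiveOnHom_of_isLE_of_isGE (X := (t.truncLT b).obj X) F (b - 1) b (by lia)) h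
    (bijectiveOnHom_of_isLE_of_isGE (X := ((t.truncLT b).obj X)⟦(1 : ℤ)⟧) F (b - 2) b (by lia)) h'

lemma bijective_mapExactFunctor_iff [HasExt.{w₃} C] [HasExt.{w₄} D] (X Y : C) (i : ℕ) :
    Function.Bijective (fun e : Abelian.Ext.{w₃} X Y i ↦
      (e.mapExactFunctor F : Abelian.Ext.{w₄} (F.obj X) (F.obj Y) i)) ↔
    BijectiveOnHom F.mapDerivedCategory ((singleFunctor C 0).obj X)
      (((singleFunctor C 0).obj Y)⟦(i : ℤ)⟧) := by
  let e := Iso.homCongr ((F.mapDerivedCategorySingleFunctor 0).app X)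
    ((F.mapDerivedCategory.commShiftIso (i : ℤ)).app ((singleFunctor C 0).obj Y) ≪≫
      (shiftFunctor _ (i : ℤ)).mapIso ((F.mapDerivedCategorySingleFunctor 0).app Y))
  have comm : Abelian.Ext.homEquiv ∘ (fun e : Abelian.Ext.{w₃} X Y i ↦
      (e.mapExactFunctor F : Abelian.Ext.{w₄} (F.obj X) (F.obj Y) i)) =
      e ∘ F.mapDerivedCategory.map ∘ Abelian.Ext.homEquiv := by
    ext x
    refine (Abelian.Ext.mapExactFunctor_hom F x).trans ?_
    simp [e, Iso.homCongr, ShiftedHom.map]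
  rw [← Function.Bijective.of_comp_iff' Abelian.Ext.homEquiv.bijective, comm,
    Function.Bijective.of_comp_iff' e.bijective,
    Function.Bijective.of_comp_iff _ Abelian.Ext.homEquiv.bijective, BijectiveOnHom]

lemma bijectiveOnHom_mapDerivedCategoryMinus_iff (X Y : DerivedCategory.Minus C) :
    BijectiveOnHom F.mapDerivedCategoryMinus X Y ↔
      BijectiveOnHom F.mapDerivedCategory X.obj Y.obj :=
  (bijectiveOnHom_comp_iff (F := F.mapDerivedCategoryMinus) Minus.ι X Y).symm.trans
    (bijectiveOnHom_obj_iff Minus.ι X Y).symm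

section

variable {F}

lemma bijectiveTargets_singleFunctor {X Y : C}
    (h : ∀ i : ℕ, BijectiveOnHom F.mapDerivedCategory ((singleFunctor C 0).obj X)
      (((singleFunctor C 0).obj Y)⟦(i : ℤ)⟧)) :
    bijectiveTargets F.mapDerivedCategory ((singleFunctor C 0).obj X)
      ((singleFunctor C 0).obj Y) := by
  intro n
  obtain hn | hn := le_or_gt 0 n
  · obtain ⟨i, rfl⟩ := Int.eq_ofNat_of_zero_le hn
    exact h i
  · have := t.isGE_shift ((singleFunctor C 0).obj Y) 0 n (-n)
    exact bijectiveOnHom_of_isLE_of_isGE F 0 (-n) (by lia)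

lemma bijectiveSources_of_minus {X Y : DerivedCategory C} {c : ℤ} [Y.IsGE c]
    (h : ∀ X' : C, bijectiveSources F.mapDerivedCategory Y ((singleFunctor C 0).obj X'))
    (hX : t.minus X) : bijectiveSources F.mapDerivedCategory Y X := by
  obtain ⟨a, _⟩ := hX
  intro n
  have := t.isGE_shift Y c n (c - n)
  have bijectiveSources_truncGE :
      bijectiveSources F.mapDerivedCategory Y ((t.truncGE (c - n)).obj X) :=
    prop_of_singleFunctor_of_isGE_of_isLE _ h _ (c - n) a
  exact bijectiveOnHom_of_truncGE F (c - n) (bijectiveSources_truncGE n)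
    (ObjectProperty.le_shift _ (-1) _ bijectiveSources_truncGE n)

lemma bijectiveOnHom_of_minus [HasProductsOfShape ℕ C] [HasExactLimitsOfShape (Discrete ℕ) C]
    [HasProductsOfShape ℕ D] [HasExactLimitsOfShape (Discrete ℕ) D]
    [PreservesLimitsOfShape (Discrete ℕ) F]
    (h : ∀ (X Y : C) (i : ℕ), BijectiveOnHom F.mapDerivedCategory ((singleFunctor C 0).obj X)
      (((singleFunctor C 0).obj Y)⟦(i : ℤ)⟧))
    {X Y : DerivedCategory C} (hX : t.minus X) (hY : t.minus Y) :
    BijectiveOnHom F.mapDerivedCategory X Y := by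
  have := mapDerivedCategory_preservesProducts (J := ℕ) F
  have targets_single (Y' : C) :
      bijectiveTargets F.mapDerivedCategory X ((singleFunctor C 0).obj Y') :=
    bijectiveSources_of_minus (c := 0) (fun X' ↦ bijectiveTargets_singleFunctor (h X' Y')) hX
  have targets : bijectiveTargets F.mapDerivedCategory X Y :=
    prop_of_singleFunctor_of_minus _ targets_single hY
  exact (targets 0).of_iso (Iso.refl _) ((shiftFunctorZero _ ℤ).app Y)

end

theorem mainTheorem8_general [HasProductsOfShape ℕ C] [HasExactLimitsOfShape (Discrete ℕ) C]
    [HasProductsOfShape ℕ D] [HasExactLimitsOfShape (Discrete ℕ) D]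
    [PreservesLimitsOfShape (Discrete ℕ) F] [HasExt.{w₃} C] [HasExt.{w₄} D] :
    (∀ (X Y : C) (i : ℕ), Function.Bijective (fun e : Abelian.Ext.{w₃} X Y i ↦
      (e.mapExactFunctor F : Abelian.Ext.{w₄} (F.obj X) (F.obj Y) i))) ↔
    (F.mapDerivedCategoryMinus.Full ∧ F.mapDerivedCategoryMinus.Faithful) := by
  simp only [bijective_mapExactFunctor_iff, full_and_faithful_iff_bijectiveOnHom,
    bijectiveOnHom_mapDerivedCategoryMinus_iff]
  have minus_single (X : C) : t.minus ((singleFunctor C 0).obj X) := ⟨0, inferInstance⟩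
  exact ⟨fun h X Y ↦ bijectiveOnHom_of_minus h X.property Y.property, fun h X Y i ↦
    h ⟨_, minus_single X⟩ ⟨_, ObjectProperty.le_shift _ (i : ℤ) _ (minus_single Y)⟩⟩

end Devissage

section HomFunctor

variable {B : Type u} [Category.{v} B] [Abelian B] {P : B} {R : Type v} [Ring R]
  (θ : R →+* (End P)ᵐᵒᵖ)

instance homFunctor_preservesLimits : PreservesLimits (homFunctor P θ) := by
  have : PreservesLimits (ModuleCat.restrictScalars.{v} θ) := ⟨⟨inferInstance⟩⟩
  exact comp_preservesLimits (preadditiveCoyonedaObj P) _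

lemma hasExactCountableProducts_of_isSeparator [HasProductsOfShape ℕ B] [Projective P]
    (hP : IsSeparator P) : HasExactLimitsOfShape (Discrete ℕ) B := by
  have : (preadditiveCoyonedaObj P).Faithful :=
    (isSeparator_iff_faithful_preadditiveCoyonedaObj P).1 hP
  have : PreservesLimitsOfSize.{0, 0} (preadditiveCoyonedaObj P) :=
    preservesSmallestLimits_of_preservesLimits (preadditiveCoyonedaObj P)
  exact HasExactLimitsOfShape.domain_of_functor (Discrete ℕ) (preadditiveCoyonedaObj P)

end HomFunctor

theorem mainTheorem8 {B : Type u} [Category.{v} B] [Abelian B] [IsLocallyPresentable.{v} B]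
    (P : B) [Projective P] (hP : IsSeparator P)
    {R : Type v} [Ring R] (θ : R →+* (End P)ᵐᵒᵖ)
    [HasExt.{w₁} B] [HasDerivedCategory.{w₂} B]
    [HasDerivedCategory.{w₃} (ModuleCat.{v} R)] :
    (∀ (X Y : B) (i : ℕ), Function.Bijective
      (fun e : Abelian.Ext.{w₁} X Y i ↦ (e.mapExactFunctor (homFunctor P θ) :
        Abelian.Ext.{v} ((homFunctor P θ).obj X) ((homFunctor P θ).obj Y) i))) ↔
    ((homFunctor P θ).mapDerivedCategoryMinus.Full ∧
      (homFunctor P θ).mapDerivedCategoryMinus.Faithful) := by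
  have : HasSeparator B := ⟨⟨P, hP⟩⟩
  have : HasColimits B := by
    obtain ⟨κ, _, _⟩ := IsLocallyPresentable.exists_cardinal.{v} B
    infer_instance
  have : HasLimits B := hasLimits_of_hasColimits_of_hasSeparator
  have : HasExactLimitsOfShape (Discrete ℕ) B := hasExactCountableProducts_of_isSeparator hP
  have : PreservesLimitsOfSize.{0, 0} (homFunctor P θ) :=
    preservesSmallestLimits_of_preservesLimits _
  exact mainTheorem8_general (homFunctor P θ)
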